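/- Let $G$ be the complete graph with self-loops on a finite vertex set $V$ with $n=|V|$ (so that each step of the simple random walk on $G$ is uniform on $V$), and let $r\in V$. Consider the algorithm Hybrid$(G,1)$: (1) Run a simple random walk $(X_t)_{t\ge 0}$ on $G$ from $X_0=r$ until the time $\sigma$ at which the first Aldous-Broder branch is finished. Here, with $V_t=\{X_0,\dots,X_t\}$ and $\eta$ the cover time, $\sigma^{\rm out}=\inf\{t>0: X_t\notin V_{t-1}\}\wedge\eta$ and $\sigma=\inf\{t>\sigma^{\rm out}: X_t\in V_{t-1}\}\wedge\eta$. Let $T$ be the tree with vertex set $V_\sigma$ and the first-entrance edges $\{X_t,X_{t+1}\}$, $t<\sigma$, $X_{t+1}\notin V_t$. (2) Run Wilson's algorithm from the initial tree $T$: while some vertex is not in $T$, choose a vertex outside $T$ uniformly at random, run a simple random walk from it until it first hits $T$, and add the chronological loop erasure of its trajectory to $T$. The expected number of random-walk steps taken by Hybrid$(G,1)$ is $n+\Theta(\sqrt n)$. More precisely, there are constants $0<c\le C$ and $N$ such that, for every $n\ge N$ and every choice of the root $r$, the expected total number of random-walk steps lies between $n+c\sqrt n$ and $n+C\sqrt n$,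 and the expected number of steps in phase (1) lies between $c\sqrt n$ and $C\sqrt n$. Moreover, for every $n\ge 2$, the expected number of random-walk steps in phase (2) is exactly $n-2$ (and so $n+O(1)$). -/

import Mathlib

open MeasureTheory ProbabilityTheory

noncomputable section

/-- A finite undirected graph in which self-loops are allowed. -/
structure LoopGraph (V : Type*) where
  Adj : V → V → Prop
  symm : ∀ v w, Adj v w → Adj w v

/-- The complete graph with self-loops: any two (possibly equal) vertices are adjacent. -/
def LoopGraph.complete (V : Type*) : LoopGraph V where
  Adj _ _ := True
  symm _ _ h := h

/-- One step of the simple random walk on `G` from `v`: the next vertex is uniform among the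
neighbours of `v` (a self-loop makes `v` one of its own neighbours).  At a vertex that has no
neighbour the walk stays put. -/
def LoopGraph.walkStep {V : Type*} [Fintype V] (G : LoopGraph V) (v : V) : PMF V :=
  open Classical in
  if h : (Finset.univ.filter (G.Adj v)).Nonempty then
    PMF.uniformOfFinset (Finset.univ.filter (G.Adj v)) h
  else PMF.pure v

/-! ### Stopping times of the Aldous-Broder walk

A list `x` of length `t + 1` stands for the trajectory `X₀, …, X_t` observed up to time `t`.
The stopping times below are evaluated on the observed trajectory; the value `⊤` means that the
time in question has not occurred yet. -/

/-- `X_k ∉ V_{k-1} = {X₀, …, X_{k-1}}`. -/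
def IsNewAt {V : Type*} (x : List V) (k : ℕ) : Prop :=
  ∃ h : k < x.length, x[k] ∉ x.take k

/-- `X_k ∈ V_{k-1} = {X₀, …, X_{k-1}}`. -/
def IsRevisitAt {V : Type*} (x : List V) (k : ℕ) : Prop :=
  ∃ h : k < x.length, x[k] ∈ x.take k

/-- The cover time `η`. -/
def coverTime {V : Type*} (x : List V) : ℕ∞ :=
  sInf {t : ℕ∞ | ∃ k : ℕ, t = k ∧ k < x.length ∧ ∀ v : V, v ∈ x.take (k + 1)}

/-- `inf {t > s : X_t ∉ V_{t-1}} ∧ η`. -/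
def firstNewAfter {V : Type*} (x : List V) (s : ℕ∞) : ℕ∞ :=
  sInf {t : ℕ∞ | ∃ k : ℕ, t = k ∧ s < k ∧ IsNewAt x k} ⊓ coverTime x

/-- `inf {t > s : X_t ∈ V_{t-1}} ∧ η`. -/
def firstRevisitAfter {V : Type*} (x : List V) (s : ℕ∞) : ℕ∞ :=
  sInf {t : ℕ∞ | ∃ k : ℕ, t = k ∧ s < k ∧ IsRevisitAt x k} ⊓ coverTime x

/-- The time `σⁱⁿ_i` at which the `i`-th Aldous-Broder branch is finished: `σⁱⁿ_0 = 0`,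
`σᵒᵘᵗ_{i+1} = inf {t > σⁱⁿ_i : X_t ∉ V_{t-1}} ∧ η` and
`σⁱⁿ_{i+1} = inf {t > σᵒᵘᵗ_{i+1} : X_t ∈ V_{t-1}} ∧ η`. -/
def sigmaIn {V : Type*} (x : List V) : ℕ → ℕ∞
  | 0 => 0
  | i + 1 => firstRevisitAfter x (firstNewAfter x (sigmaIn x i))

/-! ### Trees and loop erasure -/

/-- A partially built tree `(V_X, E_X)`. -/
structure PartialTree (V : Type*) where
  verts : Finset V
  edges : Finset (Sym2 V)

open Classical in
/-- The tree built by Aldous-Broder along the trajectory `x`: all visited vertices, and the edges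
`{X_t, X_{t+1}}` such that `X_{t+1} ≠ X_k` for all `k ≤ t`. -/
def firstEntranceTree {V : Type*} [Fintype V] [DecidableEq V] (x : List V) : PartialTree V where
  verts := x.toFinset
  edges :=
    Finset.univ.filter fun e =>
      ∃ (t : ℕ) (h : t + 1 < x.length), x[t + 1] ∉ x.take (t + 1) ∧ e = s(x[t], x[t + 1])

/-- Append the vertex `w` to the loop-free path `p`; if `w` already lies on `p`, the loop just
created is erased, that is, `p` is cut back to its visit of `w`. -/
def loopErasedAppend {V : Type*} [DecidableEq V] (p : List V) (w : V) : List V :=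
  p.takeWhile (fun u => decide (u ≠ w)) ++ [w]

/-- The chronological loop erasure of a trajectory. -/
def loopErasure {V : Type*} [DecidableEq V] (y : List V) : List V :=
  y.foldl loopErasedAppend []

/-- `V_X ← V_X ∪ V(p)` and `E_X ← E_X ∪ E(p)` for a path `p`. -/
def PartialTree.addPath {V : Type*} [DecidableEq V] (T : PartialTree V) (p : List V) :
    PartialTree V where
  verts := T.verts ∪ p.toFinset
  edges := T.edges ∪ (List.zipWith (fun u v => s(u, v)) p p.tail).toFinset

/-! ### The algorithm `Hybrid(G, i)`

It is run as a Markov chain on configurations.  Leaving a configuration that is not halted takes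
exactly one step of a random walk; everything else (testing the stopping rule, building the tree,
choosing the next start vertex) is done within that transition and is free of charge. -/

/-- Configurations of the algorithm. -/
inductive Config (V : Type*) where
  /-- Aldous-Broder is running; `x` is the trajectory of its walk so far. -/
  | aldousBroder (x : List V)
  /-- Wilson is running; `T` is the current tree and `y` is the trajectory so far of the walk
  that builds the next branch. -/
  | wilson (T : PartialTree V) (y : List V)
  /-- The algorithm has returned `T`. -/
  | halted (T : PartialTree V)

/-- The head of Wilson's loop: return `T` if it contains every vertex; otherwise choose a
vertex outside `T` uniformly at random and start a walk there. -/
def wilsonLoop {V : Type*} [Fintype V] [DecidableEq V] (T : PartialTree V) : PMF (Config V) :=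
  if h : (Finset.univ \ T.verts).Nonempty then
    (PMF.uniformOfFinset (Finset.univ \ T.verts) h).map fun v => Config.wilson T [v]
  else PMF.pure (Config.halted T)

/-- After Wilson's walk has moved: `y` is its trajectory, `w` its present position.  If `w` is in
the tree, the loop erasure of `y` is added to the tree and the loop is entered again. -/
def wilsonUpdate {V : Type*} [Fintype V] [DecidableEq V] (T : PartialTree V) (y : List V) (w : V) :
    PMF (Config V) :=
  if w ∈ T.verts then wilsonLoop (T.addPath (loopErasure y))
  else PMF.pure (Config.wilson T y)

/-- Aldous-Broder with trajectory `x` so far: if the `i`-th branch is finished, Wilson takes over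
with the tree built so far; otherwise the walk goes on. -/
def aldousBroderUpdate {V : Type*} [Fintype V] [DecidableEq V] (i : ℕ) (x : List V) :
    PMF (Config V) :=
  open Classical in
  if sigmaIn x i ≠ ⊤ then wilsonLoop (firstEntranceTree x)
  else PMF.pure (Config.aldousBroder x)

/-- The transition law of `Hybrid(G, i)`. -/
def hybridStep {V : Type*} [Fintype V] [DecidableEq V] (G : LoopGraph V) (i : ℕ) :
    Config V → PMF (Config V)
  | .aldousBroder x =>
    match x.getLast? with
    | some v => (G.walkStep v).bind fun w => aldousBroderUpdate i (x ++ [w])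
    | none => PMF.pure (.aldousBroder x) -- no trajectory is empty
  | .wilson T y =>
    match y.getLast? with
    | some v => (G.walkStep v).bind fun w => wilsonUpdate T (y ++ [w]) w
    | none => PMF.pure (.wilson T y) -- no trajectory is empty
  | .halted T => PMF.pure (.halted T)

/-- The initial configuration of `Hybrid(G, i)` with root `r`: the walk is at `X₀ = r`. -/
def hybridInit {V : Type*} [Fintype V] [DecidableEq V] (i : ℕ) (r : V) : PMF (Config V) :=
  aldousBroderUpdate i [r]

instance {V : Type*} : MeasurableSpace (Config V) := ⊤

/-- The transition law as a kernel that reads the last configuration of the past. -/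
def hybridKernel {V : Type*} [Fintype V] [DecidableEq V] (G : LoopGraph V) (i n : ℕ) :
    Kernel (Π _ : Finset.Iic n, Config V) (Config V) where
  toFun past := (hybridStep G i (past ⟨n, Finset.mem_Iic.2 le_rfl⟩)).toMeasure
  measurable' :=
    (measurable_from_top (f := fun s : Config V => (hybridStep G i s).toMeasure)).comp
      (measurable_pi_apply _)

instance {V : Type*} [Fintype V] [DecidableEq V] (G : LoopGraph V) (i n : ℕ) :
    IsMarkovKernel (hybridKernel G i n) :=
  ⟨fun past => PMF.toMeasure.isProbabilityMeasure
    (hybridStep G i (past ⟨n, Finset.mem_Iic.2 le_rfl⟩))⟩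

/-- The law of a run of `Hybrid(G, i)` with root `r`: a probability measure on the space of
infinite sequences of configurations. -/
def hybridRun {V : Type*} [Fintype V] [DecidableEq V] (G : LoopGraph V) (i : ℕ) (r : V) :
    Measure (ℕ → Config V) :=
  Kernel.trajMeasure (X := fun _ => Config V) (hybridInit i r).toMeasure (hybridKernel G i)

/-! ### Counting random-walk steps -/

/-- The number of random-walk steps taken in a run. -/
def walkSteps {V : Type*} (ω : ℕ → Config V) : ℕ∞ :=
  {t : ℕ | ∀ T, ω t ≠ .halted T}.encard

/-- The number of random-walk steps taken in the Aldous-Broder phase of a run. -/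
def aldousBroderSteps {V : Type*} (ω : ℕ → Config V) : ℕ∞ :=
  {t : ℕ | ∃ x, ω t = .aldousBroder x}.encard

/-- The number of random-walk steps taken in the Wilson phase of a run. -/
def wilsonSteps {V : Type*} (ω : ℕ → Config V) : ℕ∞ :=
  {t : ℕ | ∃ T y, ω t = .wilson T y}.encard

/-- The expectation of a `ℕ∞`-valued quantity over the runs of `Hybrid(G, i)` with root `r`. -/
def hybridExpect {V : Type*} [Fintype V] [DecidableEq V] (G : LoopGraph V) (i : ℕ) (r : V)
    (f : (ℕ → Config V) → ℕ∞) : ENNReal :=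
  ∫⁻ ω, (f ω : ENNReal) ∂(hybridRun G i r)

end

/-!
The time spent in either phase is computed by potentials that depend only on sizes. Such a potential
is compared with its mean after one step: if it drops on average by at least (at most) the cost of
the step, its initial value is an upper (lower) bound for the expected total cost.

The expected length of Wilson's algorithm started from a tree on `k` vertices is the trace of the
Green function of the walk killed on the tree, here `(n - k) (1 + 1 / k)`. Subtracting
`∑ k / (k + j)` over `1 ≤ j < l` gives the expected remaining length when the current loop-erased
path has `l` vertices. During the Aldous-Broder branch the corresponding potential is `n - k` for
`k ≥ 2` visited vertices: a step ends the branch with probability `k / n` and then gains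
`(n - k) / k`, and otherwise loses `1` by visiting a new vertex, so the two effects cancel exactly.
The branch cannot end before `k = 2`, hence the initial value `n - 2`.

Since a step from `k ≥ 2` visited vertices ends the branch with probability `k / n`, the branch
lasts about `min √n (n / k)` more steps. The potential `n / (k + √n)` is of this order, drops by a
constant order in each step, and has an initial value of order `√n`.
-/

noncomputable section

open Filter
open scoped ENNReal NNReal Topology

/-! ### Expectations over a probability mass function -/

section PMFExpect

variable {α β : Type*}

/-- The expectation of a nonnegative function under a probability mass function. -/
def pmfExpect (p : PMF α) (F : α → ℝ≥0∞) : ℝ≥0∞ := ∑' a, p a * F a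

lemma pmfExpect_pure (a : α) (F : α → ℝ≥0∞) : pmfExpect (PMF.pure a) F = F a := by
  rw [pmfExpect, tsum_eq_single a fun b hb => by rw [PMF.pure_apply, if_neg hb, zero_mul]]
  simp

lemma pmfExpect_bind (p : PMF α) (f : α → PMF β) (F : β → ℝ≥0∞) :
    pmfExpect (p.bind f) F = pmfExpect p fun a => pmfExpect (f a) F := by
  simp only [pmfExpect, PMF.bind_apply, ← ENNReal.tsum_mul_right, ← ENNReal.tsum_mul_left]
  rw [ENNReal.tsum_comm]
  simp only [mul_assoc]

lemma pmfExpect_map (p : PMF α) (f : α → β) (F : β → ℝ≥0∞) :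
    pmfExpect (p.map f) F = pmfExpect p (F ∘ f) := by
  simp [← PMF.bind_pure_comp, pmfExpect_bind, pmfExpect_pure, Function.comp_def]

lemma pmfExpect_uniformOfFinset (s : Finset α) (hs : s.Nonempty) (F : α → ℝ≥0∞) :
    pmfExpect (PMF.uniformOfFinset s hs) F = (s.card : ℝ≥0∞)⁻¹ * ∑ a ∈ s, F a := by
  rw [pmfExpect, tsum_eq_sum (s := s) fun a ha => by
    rw [PMF.uniformOfFinset_apply_of_notMem _ ha, zero_mul], Finset.mul_sum]
  exact Finset.sum_congr rfl fun a ha => by rw [PMF.uniformOfFinset_apply_of_mem _ ha]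

lemma pmfExpect_const (p : PMF α) (c : ℝ≥0∞) : pmfExpect p (fun _ => c) = c := by
  rw [pmfExpect, ENNReal.tsum_mul_right, p.tsum_coe, one_mul]

lemma pmfExpect_add (p : PMF α) (F G : α → ℝ≥0∞) :
    pmfExpect p (fun a => F a + G a) = pmfExpect p F + pmfExpect p G := by
  simp only [pmfExpect, mul_add, ENNReal.tsum_add]

lemma pmfExpect_const_mul (p : PMF α) (c : ℝ≥0∞) (F : α → ℝ≥0∞) :
    pmfExpect p (fun a => c * F a) = c * pmfExpect p F := by
  simp only [pmfExpect, ← ENNReal.tsum_mul_left, mul_left_comm]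

lemma pmfExpect_mono {p : PMF α} {F G : α → ℝ≥0∞} (h : ∀ a ∈ p.support, F a ≤ G a) :
    pmfExpect p F ≤ pmfExpect p G := by
  refine ENNReal.tsum_le_tsum fun a => ?_
  by_cases ha : a ∈ p.support
  · gcongr
    exact h a ha
  · simp [(PMF.apply_eq_zero_iff p a).2 ha]

lemma lintegral_toMeasure_eq_pmfExpect [MeasurableSpace α] [DiscreteMeasurableSpace α]
    (p : PMF α) (F : α → ℝ≥0∞) : ∫⁻ a, F a ∂p.toMeasure = pmfExpect p F := by
  have hp : p.toMeasure = Measure.sum fun a => p a • Measure.dirac a := by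
    ext s hs
    rw [PMF.toMeasure_apply _ hs, Measure.sum_apply _ hs]
    refine tsum_congr fun a => ?_
    by_cases h : a ∈ s <;> simp [h, hs]
  rw [hp, lintegral_sum_measure]
  refine tsum_congr fun a => ?_
  rw [lintegral_smul_measure, lintegral_dirac' _ .of_discrete, smul_eq_mul]

end PMFExpect

/-! ### Markov chains and their marginal laws -/

section MarkovChain

variable {α : Type*} {p₀ : PMF α} {P : α → PMF α}

/-- The law at time `t` of the Markov chain with initial law `p₀` and transition law `P`. -/
def markovLaw (p₀ : PMF α) (P : α → PMF α) : ℕ → PMF α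
  | 0 => p₀
  | t + 1 => (markovLaw p₀ P t).bind P

lemma pmfExpect_markovLaw_succ (F : α → ℝ≥0∞) (t : ℕ) :
    pmfExpect (markovLaw p₀ P (t + 1)) F =
      pmfExpect (markovLaw p₀ P t) fun s => pmfExpect (P s) F :=
  pmfExpect_bind _ _ _

lemma support_markovLaw_subset {I : Set α} (h₀ : p₀.support ⊆ I)
    (hP : ∀ s ∈ I, (P s).support ⊆ I) (t : ℕ) : (markovLaw p₀ P t).support ⊆ I := by
  induction t with
  | zero => exact h₀
  | succ t ih =>
    rw [markovLaw, PMF.support_bind]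
    exact Set.iUnion₂_subset fun s hs => hP s (ih hs)

lemma tsum_pmfExpect_markovLaw_le {cost Φ : α → ℝ≥0∞}
    (h : ∀ t, ∀ s ∈ (markovLaw p₀ P t).support, cost s + pmfExpect (P s) Φ ≤ Φ s) :
    ∑' t, pmfExpect (markovLaw p₀ P t) cost ≤ pmfExpect p₀ Φ := by
  have hsum (T : ℕ) : ∑ t ∈ Finset.range T, pmfExpect (markovLaw p₀ P t) cost +
      pmfExpect (markovLaw p₀ P T) Φ ≤ pmfExpect p₀ Φ := by
    induction T with
    | zero => simp [markovLaw]
    | succ T ih =>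
      rw [Finset.sum_range_succ, add_assoc, pmfExpect_markovLaw_succ, ← pmfExpect_add]
      exact (add_le_add_right (pmfExpect_mono (h T)) _).trans ih
  rw [ENNReal.tsum_eq_iSup_nat]
  exact iSup_le fun T => le_self_add.trans (hsum T)

/-- Summability of the expectations of `D` forces the mean of the potential to vanish in the limit,
so that no part of its initial value is left over. -/
lemma pmfExpect_le_tsum_markovLaw {cost Φ D : α → ℝ≥0∞} {C : ℝ≥0∞}
    (h : ∀ t, ∀ s ∈ (markovLaw p₀ P t).support, Φ s ≤ cost s + pmfExpect (P s) Φ)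
    (hC : C ≠ ∞) (hΦ : ∀ t, ∀ s ∈ (markovLaw p₀ P t).support, Φ s ≤ C * D s)
    (hD : ∑' t, pmfExpect (markovLaw p₀ P t) D ≠ ∞) :
    pmfExpect p₀ Φ ≤ ∑' t, pmfExpect (markovLaw p₀ P t) cost := by
  have hsum (T : ℕ) : pmfExpect p₀ Φ ≤ ∑ t ∈ Finset.range T, pmfExpect (markovLaw p₀ P t) cost +
      pmfExpect (markovLaw p₀ P T) Φ := by
    induction T with
    | zero => simp [markovLaw]
    | succ T ih =>
      rw [Finset.sum_range_succ, add_assoc, pmfExpect_markovLaw_succ, ← pmfExpect_add]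
      exact ih.trans (add_le_add_right (pmfExpect_mono (h T)) _)
  have hbound (T : ℕ) : pmfExpect p₀ Φ ≤ ∑' t, pmfExpect (markovLaw p₀ P t) cost +
      C * pmfExpect (markovLaw p₀ P T) D := by
    rw [← pmfExpect_const_mul]
    exact (hsum T).trans (add_le_add (ENNReal.sum_le_tsum _) (pmfExpect_mono (hΦ T)))
  have hlim : Tendsto (fun T => ∑' t, pmfExpect (markovLaw p₀ P t) cost +
      C * pmfExpect (markovLaw p₀ P T) D) atTop
      (𝓝 (∑' t, pmfExpect (markovLaw p₀ P t) cost + C * 0)) :=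
    tendsto_const_nhds.add (ENNReal.Tendsto.const_mul
      (ENNReal.tendsto_atTop_zero_of_tsum_ne_top hD) (Or.inr hC))
  simpa using ge_of_tendsto' hlim hbound

variable [MeasurableSpace α]

lemma lintegral_trajMeasure_zero {μ₀ : Measure α} [IsProbabilityMeasure μ₀]
    {κ : (n : ℕ) → Kernel (Π _ : Finset.Iic n, α) α} [∀ n, IsMarkovKernel (κ n)]
    {F : α → ℝ≥0∞} (hF : Measurable F) :
    ∫⁻ ω, F (ω 0) ∂Kernel.trajMeasure (X := fun _ => α) μ₀ κ = ∫⁻ a, F a ∂μ₀ := by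
  let e := MeasurableEquiv.piUnique fun _ : Finset.Iic 0 => α
  have hmap : (Kernel.trajMeasure (X := fun _ => α) μ₀ κ).map
      (Preorder.frestrictLe (π := fun _ => α) 0) = μ₀.map e.symm := by
    rw [Kernel.trajMeasure, Measure.map_comp _ _ (by fun_prop), Kernel.traj_map_frestrictLe,
      Kernel.partialTraj_self, Measure.id_comp]
  have hFe : Measurable fun past => F (e past) := hF.comp e.measurable
  calc ∫⁻ ω, F (ω 0) ∂Kernel.trajMeasure (X := fun _ => α) μ₀ κ
      = ∫⁻ past, F (e past) ∂(Kernel.trajMeasure (X := fun _ => α) μ₀ κ).map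
          (Preorder.frestrictLe (π := fun _ => α) 0) :=
        by rw [lintegral_map hFe (Preorder.measurable_frestrictLe 0)]; rfl
    _ = ∫⁻ a, F a ∂μ₀ := by
        rw [hmap, lintegral_map hFe e.symm.measurable]
        simp only [MeasurableEquiv.apply_symm_apply]

lemma lintegral_trajMeasure_succ {μ₀ : Measure α} [IsProbabilityMeasure μ₀]
    {κ : (n : ℕ) → Kernel (Π _ : Finset.Iic n, α) α} [∀ n, IsMarkovKernel (κ n)]
    {F : α → ℝ≥0∞} (hF : Measurable F) (t : ℕ) :
    ∫⁻ ω, F (ω (t + 1)) ∂Kernel.trajMeasure (X := fun _ => α) μ₀ κ =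
      ∫⁻ ω, ∫⁻ a, F a ∂κ t (Preorder.frestrictLe t ω)
        ∂Kernel.trajMeasure (X := fun _ => α) μ₀ κ := by
  have hlaw := congrArg (fun m => ∫⁻ z, F z.2 ∂m)
    (Kernel.map_frestrictLe_trajMeasure_compProd_eq_map_trajMeasure
      (X := fun _ => α) (μ₀ := μ₀) (κ := κ) (a := t))
  beta_reduce at hlaw
  rw [Measure.lintegral_compProd (by fun_prop), lintegral_map (by fun_prop) (by fun_prop),
    lintegral_map (by fun_prop) (by fun_prop)] at hlaw
  exact hlaw.symm

lemma lintegral_trajMeasure_eq_pmfExpect_markovLaw [DiscreteMeasurableSpace α]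
    {κ : (n : ℕ) → Kernel (Π _ : Finset.Iic n, α) α} [∀ n, IsMarkovKernel (κ n)]
    (hκ : ∀ n past, κ n past = (P (past ⟨n, Finset.mem_Iic.2 le_rfl⟩)).toMeasure)
    (F : α → ℝ≥0∞) (t : ℕ) :
    ∫⁻ ω, F (ω t) ∂Kernel.trajMeasure (X := fun _ => α) p₀.toMeasure κ =
      pmfExpect (markovLaw p₀ P t) F := by
  induction t generalizing F with
  | zero => rw [lintegral_trajMeasure_zero .of_discrete, lintegral_toMeasure_eq_pmfExpect]; rfl
  | succ t ih =>
    rw [lintegral_trajMeasure_succ .of_discrete, pmfExpect_markovLaw_succ, ← ih]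
    refine lintegral_congr fun ω => ?_
    rw [hκ, lintegral_toMeasure_eq_pmfExpect]
    rfl

end MarkovChain

/-! ### Runs of the hybrid algorithm -/

section HybridRun

instance {V : Type*} : DiscreteMeasurableSpace (Config V) := ⟨fun _ => trivial⟩

/-- The law of the configuration of `Hybrid(G, i)` with root `r` at time `t`. -/
def hybridLaw {V : Type*} [Fintype V] [DecidableEq V] (G : LoopGraph V) (i : ℕ) (r : V) :
    ℕ → PMF (Config V) :=
  markovLaw (hybridInit i r) (hybridStep G i)

/-- The cost function that charges `α` for a step of the Aldous-Broder phase and `β` for a step of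
Wilson's phase. -/
def phaseCost {V : Type*} (α β : ℝ≥0) : Config V → ℝ≥0∞
  | .aldousBroder _ => α
  | .wilson _ _ => β
  | .halted _ => 0

variable {V : Type*} [Fintype V] [DecidableEq V] (G : LoopGraph V) (i : ℕ) (r : V)

lemma hybridExpect_encard (S : Set (Config V)) :
    hybridExpect G i r (fun ω => {t : ℕ | ω t ∈ S}.encard) =
      ∑' t, pmfExpect (hybridLaw G i r t) (S.indicator 1) := by
  have hlaw (t : ℕ) : pmfExpect (hybridLaw G i r t) (S.indicator 1) =
      ∫⁻ ω, S.indicator 1 (ω t) ∂hybridRun G i r :=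
    (lintegral_trajMeasure_eq_pmfExpect_markovLaw (fun _ _ => rfl) _ t).symm
  have hmeas (t : ℕ) : Measurable fun ω : ℕ → Config V => S.indicator (1 : Config V → ℝ≥0∞) (ω t) :=
    (Measurable.of_discrete (f := S.indicator 1)).comp (measurable_pi_apply t)
  simp only [hlaw, hybridExpect]
  rw [← lintegral_tsum fun t => (hmeas t).aemeasurable]
  refine lintegral_congr fun ω => ?_
  rw [← ENNReal.tsum_set_one, tsum_subtype {t : ℕ | ω t ∈ S} fun _ => (1 : ℝ≥0∞)]
  rfl

lemma hybridExpect_aldousBroderSteps :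
    hybridExpect G i r aldousBroderSteps =
      ∑' t, pmfExpect (hybridLaw G i r t) (phaseCost 1 0) := by
  refine (hybridExpect_encard G i r {s | ∃ x, s = .aldousBroder x}).trans ?_
  refine tsum_congr fun t => congrArg _ (funext fun s => ?_)
  rcases s with x | ⟨T, y⟩ | T <;> simp [phaseCost]

lemma hybridExpect_wilsonSteps :
    hybridExpect G i r wilsonSteps =
      ∑' t, pmfExpect (hybridLaw G i r t) (phaseCost 0 1) := by
  refine (hybridExpect_encard G i r {s | ∃ T y, s = .wilson T y}).trans ?_
  refine tsum_congr fun t => congrArg _ (funext fun s => ?_)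
  rcases s with x | ⟨T, y⟩ | T <;> simp [phaseCost]

lemma hybridExpect_walkSteps :
    hybridExpect G i r walkSteps =
      ∑' t, pmfExpect (hybridLaw G i r t) (phaseCost 1 1) := by
  refine (hybridExpect_encard G i r {s | ∀ T, s ≠ .halted T}).trans ?_
  refine tsum_congr fun t => congrArg _ (funext fun s => ?_)
  rcases s with x | ⟨T, y⟩ | T <;> simp [phaseCost]

theorem hybridExpect_walkSteps_eq_add :
    hybridExpect G i r walkSteps =
      hybridExpect G i r aldousBroderSteps + hybridExpect G i r wilsonSteps := by
  rw [hybridExpect_walkSteps, hybridExpect_aldousBroderSteps, hybridExpect_wilsonSteps,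
    ← ENNReal.tsum_add]
  refine tsum_congr fun t => ?_
  rw [← pmfExpect_add]
  refine congrArg _ (funext fun s => ?_)
  rcases s with x | ⟨T, y⟩ | T <;> simp [phaseCost]

end HybridRun

/-! ### The end of the first Aldous-Broder branch -/

lemma toFinset_append_singleton {V : Type*} [DecidableEq V] (x : List V) (w : V) :
    (x ++ [w]).toFinset = insert w x.toFinset := by
  ext; simp

section Stopping

variable {V : Type*} {x : List V} {w : V}

lemma coverTime_eq_top_iff (hx : x ≠ []) : coverTime x = ⊤ ↔ ¬ ∀ v, v ∈ x := by
  have hpos := List.length_pos_iff.2 hx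
  rw [coverTime, sInf_eq_top]
  constructor
  · intro h hv
    refine ENat.natCast_ne_top (x.length - 1) (h _ ⟨x.length - 1, rfl, by omega, fun v => ?_⟩)
    rw [Nat.sub_add_cancel hpos, List.take_length]
    exact hv v
  · rintro h _ ⟨k, -, -, hv⟩
    exact absurd (fun v => List.mem_of_mem_take (hv v)) h

lemma sigmaIn_one_eq_top_iff (hx : x ≠ []) :
    sigmaIn x 1 = ⊤ ↔ (¬ ∀ v, v ∈ x) ∧
      ¬ ∃ j k, 0 < j ∧ j < k ∧ IsNewAt x j ∧ IsRevisitAt x k := by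
  rw [sigmaIn, sigmaIn, firstRevisitAfter, inf_eq_top_iff, coverTime_eq_top_iff hx, and_comm]
  refine and_congr_right fun hcover => ?_
  rw [firstNewAfter, (coverTime_eq_top_iff hx).2 hcover, inf_top_eq, sInf_eq_top, not_exists]
  constructor
  · rintro h j ⟨k, hj, hjk, hnew, hrevisit⟩
    refine ENat.natCast_ne_top k (h _ ⟨k, rfl, sInf_lt_iff.2 ⟨j, ⟨j, rfl, ?_, hnew⟩, ?_⟩, hrevisit⟩)
    · exact_mod_cast hj
    · exact_mod_cast hjk
  · rintro h _ ⟨k, -, hs, hrevisit⟩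
    obtain ⟨_, ⟨j, rfl, hj, hnew⟩, hjk⟩ := sInf_lt_iff.1 hs
    exact absurd ⟨k, by exact_mod_cast hj, by exact_mod_cast hjk, hnew, hrevisit⟩ (h j)

lemma isNewAt_append_singleton {k : ℕ} :
    IsNewAt (x ++ [w]) k ↔ IsNewAt x k ∨ (k = x.length ∧ w ∉ x) := by
  rcases lt_trichotomy k x.length with h | rfl | h
  · simp [IsNewAt, h, List.take_append, h.ne, Nat.lt_succ_of_lt h, Nat.sub_eq_zero_of_le h.le]
  · simp [IsNewAt]
  · simp [IsNewAt, h.ne', h.not_gt, (Nat.succ_le_of_lt h).not_gt]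

lemma isRevisitAt_append_singleton {k : ℕ} :
    IsRevisitAt (x ++ [w]) k ↔ IsRevisitAt x k ∨ (k = x.length ∧ w ∈ x) := by
  rcases lt_trichotomy k x.length with h | rfl | h
  · simp [IsRevisitAt, h, List.take_append, h.ne, Nat.lt_succ_of_lt h, Nat.sub_eq_zero_of_le h.le]
  · simp [IsRevisitAt]
  · simp [IsRevisitAt, h.ne', h.not_gt, (Nat.succ_le_of_lt h).not_gt]

lemma IsNewAt.lt_length {k : ℕ} (h : IsNewAt x k) : k < x.length := h.1

lemma IsRevisitAt.lt_length {k : ℕ} (h : IsRevisitAt x k) : k < x.length := h.1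

lemma sigmaIn_one_singleton [Nontrivial V] (r : V) : sigmaIn [r] 1 = ⊤ := by
  rw [sigmaIn_one_eq_top_iff (by simp)]
  refine ⟨by simpa using exists_ne r, ?_⟩
  rintro ⟨j, k, hj, -, hnew, -⟩
  exact absurd hnew.lt_length (by simpa using hj.ne')

variable [DecidableEq V]

lemma exists_isNewAt_iff_two_le_card : (∃ j, 0 < j ∧ IsNewAt x j) ↔ 2 ≤ x.toFinset.card := by
  induction x using List.reverseRecOn with
  | nil => simp [IsNewAt]
  | append_singleton x w ih =>
    have hsplit : (∃ j, 0 < j ∧ IsNewAt (x ++ [w]) j) ↔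
        (∃ j, 0 < j ∧ IsNewAt x j) ∨ (0 < x.toFinset.card ∧ w ∉ x) := by
      simp only [isNewAt_append_singleton, Finset.card_pos, List.toFinset_nonempty_iff,
        ← List.length_pos_iff, and_or_left, exists_or, and_left_comm, exists_eq_left]
    rw [hsplit, ih, toFinset_append_singleton]
    by_cases hw : w ∈ x
    · simp [hw]
    · rw [Finset.card_insert_of_notMem (by simpa using hw)]
      simp only [hw, not_false_eq_true, and_true]
      omega

lemma sigmaIn_one_append_eq_top_iff_of_mem (hx : x ≠ []) (h : sigmaIn x 1 = ⊤) (hw : w ∈ x) :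
    sigmaIn (x ++ [w]) 1 = ⊤ ↔ x.toFinset.card = 1 := by
  have hcover : ¬ ∀ v, v ∈ x ++ [w] := by
    refine fun hv => ((sigmaIn_one_eq_top_iff hx).1 h).1 fun v => ?_
    exact (List.mem_append.1 (hv v)).elim id fun hvw => List.mem_singleton.1 hvw ▸ hw
  have hpos : 0 < x.toFinset.card := by rwa [Finset.card_pos, List.toFinset_nonempty_iff]
  have hnew : x.toFinset.card = 1 ↔ ¬ ∃ j, 0 < j ∧ IsNewAt x j := by
    rw [exists_isNewAt_iff_two_le_card]; omega
  rw [sigmaIn_one_eq_top_iff (by simp), hnew, and_iff_right hcover, not_iff_not]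
  constructor
  · rintro ⟨j, k, hj, -, hnew, -⟩
    exact ⟨j, hj, (isNewAt_append_singleton.1 hnew).resolve_right fun h => h.2 hw⟩
  · rintro ⟨j, hj, hnew⟩
    exact ⟨j, x.length, hj, hnew.lt_length, isNewAt_append_singleton.2 (Or.inl hnew),
      isRevisitAt_append_singleton.2 (Or.inr ⟨rfl, hw⟩)⟩

variable [Fintype V]

lemma forall_mem_iff_card_toFinset : (∀ v, v ∈ x) ↔ x.toFinset.card = Fintype.card V := by
  rw [Finset.card_eq_iff_eq_univ, Finset.eq_univ_iff_forall]
  simp only [List.mem_toFinset]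

lemma sigmaIn_one_append_eq_top_iff_of_notMem (hx : x ≠ []) (h : sigmaIn x 1 = ⊤) (hw : w ∉ x) :
    sigmaIn (x ++ [w]) 1 = ⊤ ↔ x.toFinset.card + 1 ≠ Fintype.card V := by
  have hcard : (x ++ [w]).toFinset.card = x.toFinset.card + 1 := by
    rw [toFinset_append_singleton, Finset.card_insert_of_notMem (by simpa using hw)]
  rw [sigmaIn_one_eq_top_iff (by simp), forall_mem_iff_card_toFinset, hcard, and_iff_left]
  rintro ⟨j, k, hj, hjk, hnew, hrevisit⟩
  have hrevisit := (isRevisitAt_append_singleton.1 hrevisit).resolve_right fun h => hw h.2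
  refine ((sigmaIn_one_eq_top_iff hx).1 h).2 ⟨j, k, hj, hjk, ?_, hrevisit⟩
  exact (isNewAt_append_singleton.1 hnew).resolve_right fun h =>
    (hjk.trans hrevisit.lt_length).ne h.1

lemma card_toFinset_mem_Ico_of_sigmaIn_one_eq_top (hx : x ≠ []) (h : sigmaIn x 1 = ⊤) :
    x.toFinset.card ∈ Set.Ico 1 (Fintype.card V) := by
  refine ⟨Finset.card_pos.2 ((List.toFinset_nonempty_iff x).2 hx), ?_⟩
  refine (Finset.card_le_univ _).lt_of_ne ?_
  rw [ne_eq, ← forall_mem_iff_card_toFinset]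
  exact ((sigmaIn_one_eq_top_iff hx).1 h).1

end Stopping

/-! ### Loop erasure -/

section LoopErasure

variable {V : Type*} [DecidableEq V] {p y : List V} {w : V}

lemma loopErasure_append_singleton (y : List V) (w : V) :
    loopErasure (y ++ [w]) = loopErasedAppend (loopErasure y) w := by
  simp [loopErasure]

lemma loopErasure_singleton (v : V) : loopErasure [v] = [v] := by
  simp [loopErasure, loopErasedAppend]

lemma loopErasedAppend_of_notMem (h : w ∉ p) : loopErasedAppend p w = p ++ [w] := by
  rw [loopErasedAppend, List.takeWhile_eq_self_iff.2 fun u hu => by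
    simpa using ne_of_mem_of_not_mem hu h]

lemma loopErasedAppend_subset : loopErasedAppend p w ⊆ w :: p := by
  intro u hu
  rcases List.mem_append.1 hu with h | h
  · exact List.mem_cons_of_mem _ ((List.takeWhile_sublist _).subset h)
  · exact List.mem_singleton.1 h ▸ List.mem_cons_self

lemma nodup_loopErasedAppend (hp : p.Nodup) : (loopErasedAppend p w).Nodup := by
  refine (hp.sublist (List.takeWhile_sublist _)).append (List.nodup_singleton w) ?_
  simp only [List.disjoint_singleton]
  exact fun h => by simpa using List.mem_takeWhile_imp h

lemma nodup_loopErasure (y : List V) : (loopErasure y).Nodup := by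
  induction y using List.reverseRecOn with
  | nil => exact List.nodup_nil
  | append_singleton y w ih =>
    rw [loopErasure_append_singleton]
    exact nodup_loopErasedAppend ih

lemma loopErasure_ne_nil (hy : y ≠ []) : loopErasure y ≠ [] := by
  obtain ⟨y, w, rfl⟩ := (List.eq_nil_or_concat' y).resolve_left hy
  simp [loopErasure_append_singleton, loopErasedAppend]

lemma length_loopErasedAppend (p : List V) (w : V) :
    (loopErasedAppend p w).length = p.idxOf w + 1 := by
  have hneg : (fun u => !decide (u ≠ w)) = fun u => u == w := by
    ext u
    by_cases h : u = w <;> simp [h]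
  rw [loopErasedAppend, List.takeWhile_eq_take_findIdx_not, hneg]
  simp [List.idxOf, List.findIdx_le_length]

lemma sum_length_loopErasedAppend {M : Type*} [AddCommMonoid M] (hp : p.Nodup) (g : ℕ → M) :
    ∑ w ∈ p.toFinset, g (loopErasedAppend p w).length =
      ∑ j ∈ Finset.range p.length, g (j + 1) := by
  simp only [length_loopErasedAppend]
  refine Finset.sum_nbij (p.idxOf ·) ?_ ?_ ?_ fun _ _ => rfl
  · simp [List.idxOf_lt_length_iff]
  · exact fun u hu v _ h => (List.idxOf_inj (List.mem_toFinset.1 hu)).1 h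
  · intro j hj
    have hj : j < p.length := by simpa using hj
    exact ⟨p[j], by simp, List.Nodup.idxOf_getElem hp j hj⟩

end LoopErasure

/-! ### Configurations visited by the algorithm -/

section Legal

/-- The configurations that a run of `Hybrid(G, i)` can visit: the walk has a position, the `i`-th
Aldous-Broder branch is unfinished, and the loop-erased path of Wilson's walk has not yet met the
tree. -/
def Config.IsLegal {V : Type*} [DecidableEq V] (i : ℕ) : Config V → Prop
  | .aldousBroder x => x ≠ [] ∧ sigmaIn x i = ⊤
  | .wilson T y => y ≠ [] ∧ T.verts.Nonempty ∧ Disjoint T.verts (loopErasure y).toFinset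
  | .halted _ => True

variable {V : Type*} [DecidableEq V] {i : ℕ} {x y : List V} {T : PartialTree V} {w : V}

lemma Config.IsLegal.wilson_append (h : (Config.wilson T y).IsLegal i) (hw : w ∉ T.verts) :
    (Config.wilson T (y ++ [w])).IsLegal i := by
  obtain ⟨-, hT, hdisj⟩ := h
  refine ⟨by simp, hT, ?_⟩
  rw [loopErasure_append_singleton, Finset.disjoint_right]
  intro u hu
  rcases List.mem_cons.1 (loopErasedAppend_subset (List.mem_toFinset.1 hu)) with rfl | hu
  · exact hw
  · exact Finset.disjoint_right.1 hdisj (List.mem_toFinset.2 hu)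

lemma Config.IsLegal.one_le_card_verts (h : (Config.wilson T y).IsLegal i) : 1 ≤ T.verts.card :=
  Finset.card_pos.2 h.2.1

lemma Config.IsLegal.one_le_length_loopErasure (h : (Config.wilson T y).IsLegal i) :
    1 ≤ (loopErasure y).length :=
  List.length_pos_iff.2 (loopErasure_ne_nil h.1)

variable [Fintype V] {G : LoopGraph V}

lemma hybridStep_aldousBroder (hx : x ≠ []) :
    hybridStep G i (.aldousBroder x) =
      (G.walkStep (x.getLast hx)).bind fun w => aldousBroderUpdate i (x ++ [w]) := by
  rw [hybridStep, List.getLast?_eq_some_getLast hx]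

lemma hybridStep_wilson (hy : y ≠ []) :
    hybridStep G i (.wilson T y) =
      (G.walkStep (y.getLast hy)).bind fun w => wilsonUpdate T (y ++ [w]) w := by
  rw [hybridStep, List.getLast?_eq_some_getLast hy]

lemma support_wilsonLoop_subset (hT : T.verts.Nonempty) :
    (wilsonLoop T).support ⊆ {s | s.IsLegal i} := by
  intro s hs
  rw [wilsonLoop] at hs
  split_ifs at hs with h
  · obtain ⟨v, hv, rfl⟩ := (PMF.mem_support_map_iff ..).1 hs
    have hv : v ∉ T.verts := by simpa using hv
    exact ⟨by simp, hT, by simpa [loopErasure_singleton] using hv⟩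
  · obtain rfl := (PMF.mem_support_pure_iff ..).1 hs
    trivial

lemma support_aldousBroderUpdate_subset (hx : x ≠ []) :
    (aldousBroderUpdate i x).support ⊆ {s | s.IsLegal i} := by
  intro s hs
  rw [aldousBroderUpdate] at hs
  split_ifs at hs with h
  · exact support_wilsonLoop_subset (by simpa [firstEntranceTree] using hx) hs
  · obtain rfl := (PMF.mem_support_pure_iff ..).1 hs
    exact ⟨hx, not_not.1 h⟩

lemma support_hybridStep_subset {s : Config V} (hs : s.IsLegal i) :
    (hybridStep G i s).support ⊆ {s | s.IsLegal i} := by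
  rcases s with x | ⟨T, y⟩ | T
  · rw [hybridStep_aldousBroder hs.1, PMF.support_bind]
    exact Set.iUnion₂_subset fun w _ => support_aldousBroderUpdate_subset (by simp)
  · rw [hybridStep_wilson hs.1, PMF.support_bind]
    refine Set.iUnion₂_subset fun w _ => ?_
    rw [wilsonUpdate]
    split_ifs with hw
    · exact support_wilsonLoop_subset (hs.2.1.mono Finset.subset_union_left)
    · simpa using hs.wilson_append hw
  · simp [hybridStep, Config.IsLegal]

lemma support_hybridLaw_subset (r : V) (t : ℕ) :
    (hybridLaw G i r t).support ⊆ {s | s.IsLegal i} :=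
  support_markovLaw_subset (support_aldousBroderUpdate_subset (by simp))
    (fun _ => support_hybridStep_subset) t

lemma Config.IsLegal.card_verts_add_length_le (h : (Config.wilson T y).IsLegal i) :
    T.verts.card + (loopErasure y).length ≤ Fintype.card V := by
  rw [← List.toFinset_card_of_nodup (nodup_loopErasure y), ← Finset.card_union_of_disjoint h.2.2]
  exact Finset.card_le_univ _

end Legal

/-! ### Potentials that depend only on sizes -/

/-- A potential for `Hybrid(G, 1)` on `n` vertices that depends only on the number of vertices
visited by the Aldous-Broder walk (`walk`) or, in Wilson's phase, on the number of vertices of the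
tree and of the current loop-erased path (`branch`). -/
structure SizePotential (n : ℕ) where
  walk : ℕ → ℝ
  branch : ℕ → ℕ → ℝ
  walk_nonneg : ∀ k ≤ n, 0 ≤ walk k
  branch_nonneg : ∀ k l, 1 ≤ k → k + l ≤ n → 0 ≤ branch k l
  walk_self : walk n = 0
  branch_self : branch n 1 = 0

namespace SizePotential

variable {n k l : ℕ}

/-- The mean of the potential after a step of the Aldous-Broder walk that has visited `k` of the
`n` vertices: unless `k = 1`, a step to a visited vertex ends the phase. -/
def walkMean (Φ : SizePotential n) (k : ℕ) : ℝ :=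
  (n : ℝ)⁻¹ * (k * (if k = 1 then Φ.walk 1 else Φ.branch k 1) + (n - k) * Φ.walk (k + 1))

/-- The mean of the potential after a step of Wilson's walk, for a tree on `k` of the `n` vertices
and a loop-erased path on `l` vertices. -/
def branchMean (Φ : SizePotential n) (k l : ℕ) : ℝ :=
  (n : ℝ)⁻¹ * (k * Φ.branch (k + l) 1 + ∑ j ∈ Finset.range l, Φ.branch k (j + 1) +
    (n - (k + l)) * Φ.branch k (l + 1))

/-- The value of the potential at a configuration. -/
def value {V : Type*} [DecidableEq V] (Φ : SizePotential n) : Config V → ℝ≥0∞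
  | .aldousBroder x => ENNReal.ofReal (Φ.walk x.toFinset.card)
  | .wilson T y => ENNReal.ofReal (Φ.branch T.verts.card (loopErasure y).length)
  | .halted _ => 0

lemma branch_one_nonneg (Φ : SizePotential n) (hk : 1 ≤ k) (hkn : k ≤ n) : 0 ≤ Φ.branch k 1 := by
  rcases hkn.eq_or_lt with rfl | hkn
  · exact Φ.branch_self.ge
  · exact Φ.branch_nonneg k 1 hk hkn

lemma walkMean_nonneg (Φ : SizePotential n) (hk : 1 ≤ k) (hkn : k < n) : 0 ≤ Φ.walkMean k := by
  have hrevisit : 0 ≤ if k = 1 then Φ.walk 1 else Φ.branch k 1 := by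
    split_ifs with h
    · exact Φ.walk_nonneg 1 (h ▸ hkn.le)
    · exact Φ.branch_one_nonneg hk hkn.le
  have hnew := mul_nonneg (sub_nonneg.2 (Nat.cast_le (α := ℝ).2 hkn.le))
    (Φ.walk_nonneg (k + 1) hkn)
  rw [walkMean]
  positivity

lemma branchMean_nonneg (Φ : SizePotential n) (hk : 1 ≤ k) (hkl : k + l ≤ n) :
    0 ≤ Φ.branchMean k l := by
  have htree := Φ.branch_one_nonneg (Nat.le_add_right_of_le (k := l) hk) hkl
  have hpath : 0 ≤ ∑ j ∈ Finset.range l, Φ.branch k (j + 1) :=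
    Finset.sum_nonneg fun j hj => Φ.branch_nonneg k _ hk (by have := Finset.mem_range.1 hj; omega)
  have hnew : 0 ≤ ((n : ℝ) - (k + l)) * Φ.branch k (l + 1) := by
    rcases hkl.eq_or_lt with rfl | hkl
    · simp
    · refine mul_nonneg (sub_nonneg.2 ?_) (Φ.branch_nonneg k _ hk hkl)
      exact_mod_cast hkl.le
  rw [branchMean]
  positivity

end SizePotential

section Means

variable {V : Type*} [Fintype V] [DecidableEq V] (Φ : SizePotential (Fintype.card V))
  {i : ℕ} {x y : List V} {T : PartialTree V}

omit [DecidableEq V] in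
lemma pmfExpect_walkStep_complete (v : V) (F : V → ℝ≥0∞) :
    pmfExpect ((LoopGraph.complete V).walkStep v) F =
      (Fintype.card V : ℝ≥0∞)⁻¹ * ∑ w, F w := by
  classical
  have hadj (w : V) : (LoopGraph.complete V).Adj v w := trivial
  have hne : (Finset.univ.filter ((LoopGraph.complete V).Adj v)).Nonempty := ⟨v, by simp [hadj]⟩
  rw [LoopGraph.walkStep, dif_pos hne, pmfExpect_uniformOfFinset]
  simp [hadj]

omit [DecidableEq V] in
lemma pmfExpect_walkStep_complete_ofReal (v : V) {g : V → ℝ} (hg : ∀ w, 0 ≤ g w) :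
    pmfExpect ((LoopGraph.complete V).walkStep v) (fun w => ENNReal.ofReal (g w)) =
      ENNReal.ofReal ((Fintype.card V : ℝ)⁻¹ * ∑ w, g w) := by
  have hpos : (0 : ℝ) < Fintype.card V := by exact_mod_cast Fintype.card_pos_iff.2 ⟨v⟩
  rw [pmfExpect_walkStep_complete, ENNReal.ofReal_mul (by positivity),
    ENNReal.ofReal_inv_of_pos hpos, ENNReal.ofReal_natCast,
    ENNReal.ofReal_sum_of_nonneg fun w _ => hg w]

lemma pmfExpect_wilsonLoop_value :
    pmfExpect (wilsonLoop T) Φ.value = ENNReal.ofReal (Φ.branch T.verts.card 1) := by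
  rw [wilsonLoop]
  split_ifs with h
  · rw [pmfExpect_map, ← pmfExpect_const (PMF.uniformOfFinset _ h) (ENNReal.ofReal _)]
    refine congrArg _ (funext fun v => ?_)
    simp [SizePotential.value, loopErasure_singleton]
  · have hcard : T.verts.card = Fintype.card V := by
      rwa [Finset.card_eq_iff_eq_univ, ← Finset.univ_subset_iff, ← Finset.sdiff_nonempty.not_left]
    rw [pmfExpect_pure, hcard, Φ.branch_self, ENNReal.ofReal_zero, SizePotential.value]

open Classical in
lemma pmfExpect_aldousBroderUpdate_value (x : List V) :
    pmfExpect (aldousBroderUpdate 1 x) Φ.value = ENNReal.ofReal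
      (if sigmaIn x 1 = ⊤ then Φ.walk x.toFinset.card else Φ.branch x.toFinset.card 1) := by
  rw [aldousBroderUpdate]
  by_cases h : sigmaIn x 1 = ⊤
  · rw [if_neg (not_not.2 h), if_pos h, pmfExpect_pure, SizePotential.value]
  · rw [if_pos h, if_neg h, pmfExpect_wilsonLoop_value, firstEntranceTree]

lemma pmfExpect_hybridInit_value [Nontrivial V] (r : V) :
    pmfExpect (hybridInit 1 r) Φ.value = ENNReal.ofReal (Φ.walk 1) := by
  rw [hybridInit, pmfExpect_aldousBroderUpdate_value, if_pos (sigmaIn_one_singleton r)]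
  simp

lemma pmfExpect_aldousBroderUpdate_append_value (hx : (Config.aldousBroder x).IsLegal 1) (w : V) :
    pmfExpect (aldousBroderUpdate 1 (x ++ [w])) Φ.value = ENNReal.ofReal
      (if w ∈ x.toFinset then
        if x.toFinset.card = 1 then Φ.walk 1 else Φ.branch x.toFinset.card 1
      else Φ.walk (x.toFinset.card + 1)) := by
  rw [pmfExpect_aldousBroderUpdate_value, toFinset_append_singleton]
  by_cases hw : w ∈ x
  · have hw' : w ∈ x.toFinset := List.mem_toFinset.2 hw
    rw [Finset.insert_eq_of_mem hw', if_pos hw']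
    simp only [sigmaIn_one_append_eq_top_iff_of_mem hx.1 hx.2 hw]
    split_ifs with h <;> simp only [h]
  · have hw' : w ∉ x.toFinset := by rwa [List.mem_toFinset]
    rw [Finset.card_insert_of_notMem hw', if_neg hw']
    simp only [sigmaIn_one_append_eq_top_iff_of_notMem hx.1 hx.2 hw]
    split_ifs with h
    · rfl
    · rw [not_not.1 h, Φ.branch_self, Φ.walk_self]

lemma pmfExpect_wilsonUpdate_append_value (hy : (Config.wilson T y).IsLegal i) (w : V) :
    pmfExpect (wilsonUpdate T (y ++ [w]) w) Φ.value = ENNReal.ofReal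
      (if w ∈ T.verts then Φ.branch (T.verts.card + (loopErasure y).length) 1
      else Φ.branch T.verts.card (loopErasedAppend (loopErasure y) w).length) := by
  rw [wilsonUpdate]
  split_ifs with hw
  · have hwy : w ∉ loopErasure y := fun h =>
      Finset.disjoint_left.1 hy.2.2 hw (List.mem_toFinset.2 h)
    rw [pmfExpect_wilsonLoop_value, loopErasure_append_singleton, loopErasedAppend_of_notMem hwy,
      PartialTree.addPath]
    dsimp only
    rw [toFinset_append_singleton, Finset.union_insert,
      Finset.insert_eq_of_mem (Finset.mem_union_left _ hw), Finset.card_union_of_disjoint hy.2.2,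
      List.toFinset_card_of_nodup (nodup_loopErasure y)]
  · rw [pmfExpect_pure, SizePotential.value, loopErasure_append_singleton]

lemma pmfExpect_hybridStep_aldousBroder_value (hx : (Config.aldousBroder x).IsLegal 1) :
    pmfExpect (hybridStep (LoopGraph.complete V) 1 (.aldousBroder x)) Φ.value =
      ENNReal.ofReal (Φ.walkMean x.toFinset.card) := by
  obtain ⟨hpos, hlt⟩ := card_toFinset_mem_Ico_of_sigmaIn_one_eq_top hx.1 hx.2
  rw [hybridStep_aldousBroder hx.1, pmfExpect_bind]
  simp only [pmfExpect_aldousBroderUpdate_append_value Φ hx]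
  rw [pmfExpect_walkStep_complete_ofReal, Finset.sum_ite, SizePotential.walkMean]
  · simp only [Finset.sum_const, nsmul_eq_mul, Finset.filter_mem_eq_inter, Finset.univ_inter,
      Finset.filter_notMem_eq_sdiff, Finset.card_univ_sdiff, Nat.cast_sub hlt.le]
  · intro w
    split_ifs with hw h
    · exact Φ.walk_nonneg 1 (h ▸ hlt.le)
    · exact Φ.branch_one_nonneg hpos hlt.le
    · exact Φ.walk_nonneg _ hlt

lemma sum_branch_loopErasedAppend (T : PartialTree V) {p : List V} (hp : p.Nodup)
    (hdisj : Disjoint T.verts p.toFinset) :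
    ∑ w, (if w ∈ T.verts then Φ.branch (T.verts.card + p.length) 1
        else Φ.branch T.verts.card (loopErasedAppend p w).length) =
      T.verts.card * Φ.branch (T.verts.card + p.length) 1 +
        ∑ j ∈ Finset.range p.length, Φ.branch T.verts.card (j + 1) +
        (Fintype.card V - (T.verts.card + p.length)) * Φ.branch T.verts.card (p.length + 1) := by
  have hcard : (T.verts ∪ p.toFinset).card = T.verts.card + p.length := by
    rw [Finset.card_union_of_disjoint hdisj, List.toFinset_card_of_nodup hp]
  have hle : T.verts.card + p.length ≤ Fintype.card V := hcard ▸ Finset.card_le_univ _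
  rw [← Finset.sum_add_sum_compl (T.verts ∪ p.toFinset), Finset.sum_union hdisj]
  congr 2
  · rw [← nsmul_eq_mul]
    exact Finset.sum_eq_card_nsmul fun w hw => if_pos hw
  · rw [← sum_length_loopErasedAppend hp]
    exact Finset.sum_congr rfl fun w hw => if_neg (Finset.disjoint_right.1 hdisj hw)
  · rw [← Nat.cast_add, ← Nat.cast_sub hle, ← hcard, ← Finset.card_compl, ← nsmul_eq_mul]
    refine Finset.sum_eq_card_nsmul fun w hw => ?_
    have hw : w ∉ T.verts ∧ w ∉ p := by simpa using hw
    rw [if_neg hw.1, loopErasedAppend_of_notMem hw.2, List.length_append, List.length_singleton]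

lemma pmfExpect_hybridStep_wilson_value (hy : (Config.wilson T y).IsLegal i) :
    pmfExpect (hybridStep (LoopGraph.complete V) i (.wilson T y)) Φ.value =
      ENNReal.ofReal (Φ.branchMean T.verts.card (loopErasure y).length) := by
  have hpos := hy.one_le_card_verts
  rw [hybridStep_wilson hy.1, pmfExpect_bind]
  simp only [pmfExpect_wilsonUpdate_append_value Φ hy]
  rw [pmfExpect_walkStep_complete_ofReal,
    sum_branch_loopErasedAppend Φ T (nodup_loopErasure y) hy.2.2, SizePotential.branchMean]
  intro w
  split_ifs with hw
  · exact Φ.branch_one_nonneg (Nat.le_add_right_of_le hpos) hy.card_verts_add_length_le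
  · rw [← loopErasure_append_singleton]
    exact Φ.branch_nonneg _ _ hpos (hy.wilson_append hw).card_verts_add_length_le

lemma pmfExpect_hybridStep_halted_value :
    pmfExpect (hybridStep (LoopGraph.complete V) i (.halted T)) Φ.value = 0 :=
  pmfExpect_pure _ _

end Means

/-! ### Bounds on the expected cost of a run -/

namespace SizePotential

variable {V : Type*} [Fintype V] [DecidableEq V] [Nontrivial V]
  (Φ : SizePotential (Fintype.card V)) {α β : ℝ≥0}

theorem tsum_phaseCost_le
    (hwalk : ∀ k, 1 ≤ k → k < Fintype.card V → α + Φ.walkMean k ≤ Φ.walk k)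
    (hbranch : ∀ k l, 1 ≤ k → 1 ≤ l → k + l ≤ Fintype.card V →
      β + Φ.branchMean k l ≤ Φ.branch k l) (r : V) :
    ∑' t, pmfExpect (hybridLaw (LoopGraph.complete V) 1 r t) (phaseCost α β) ≤
      ENNReal.ofReal (Φ.walk 1) := by
  rw [← pmfExpect_hybridInit_value Φ r]
  refine tsum_pmfExpect_markovLaw_le fun t s hs => ?_
  have hs : s.IsLegal 1 := support_hybridLaw_subset r t hs
  rcases s with x | ⟨T, y⟩ | T
  · obtain ⟨hpos, hlt⟩ := card_toFinset_mem_Ico_of_sigmaIn_one_eq_top hs.1 hs.2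
    rw [pmfExpect_hybridStep_aldousBroder_value Φ hs, phaseCost, ← ENNReal.ofReal_coe_nnreal,
      ← ENNReal.ofReal_add α.coe_nonneg (Φ.walkMean_nonneg hpos hlt)]
    exact ENNReal.ofReal_le_ofReal (hwalk _ hpos hlt)
  · have hpos := hs.one_le_card_verts
    have hle := hs.card_verts_add_length_le
    rw [pmfExpect_hybridStep_wilson_value Φ hs, phaseCost, ← ENNReal.ofReal_coe_nnreal,
      ← ENNReal.ofReal_add β.coe_nonneg (Φ.branchMean_nonneg hpos hle)]
    exact ENNReal.ofReal_le_ofReal (hbranch _ _ hpos hs.one_le_length_loopErasure hle)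
  · rw [pmfExpect_hybridStep_halted_value, phaseCost, add_zero]
    exact zero_le

omit [Nontrivial V] in
lemma exists_value_le_mul_phaseCost :
    ∃ C ≠ ∞, ∀ s : Config V, s.IsLegal 1 → Φ.value s ≤ C * phaseCost 1 1 s := by
  let n := Fintype.card V
  refine ⟨∑ k ∈ Finset.range (n + 1), (ENNReal.ofReal (Φ.walk k) +
    ∑ l ∈ Finset.range (n + 1), ENNReal.ofReal (Φ.branch k l)), by simp, ?_⟩
  rintro (x | ⟨T, y⟩ | T) hs
  · have hk : x.toFinset.card ∈ Finset.range (n + 1) :=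
      Finset.mem_range_succ_iff.2 (Finset.card_le_univ _)
    rw [phaseCost, ENNReal.coe_one, mul_one, value]
    exact le_self_add.trans (Finset.single_le_sum_of_canonicallyOrdered
      (f := fun k => ENNReal.ofReal (Φ.walk k) + _) hk)
  · have hle := hs.card_verts_add_length_le
    have hk : T.verts.card ∈ Finset.range (n + 1) :=
      Finset.mem_range_succ_iff.2 (by omega)
    have hl : (loopErasure y).length ∈ Finset.range (n + 1) :=
      Finset.mem_range_succ_iff.2 (by omega)
    rw [phaseCost, ENNReal.coe_one, mul_one, value]
    refine le_trans ?_ (Finset.single_le_sum_of_canonicallyOrdered (f := fun k =>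
      _ + ∑ l ∈ Finset.range (n + 1), ENNReal.ofReal (Φ.branch k l)) hk)
    exact le_add_left (Finset.single_le_sum_of_canonicallyOrdered
      (f := fun l => ENNReal.ofReal (Φ.branch _ l)) hl)
  · simp [value]

theorem le_tsum_phaseCost
    (hwalk : ∀ k, 1 ≤ k → k < Fintype.card V → Φ.walk k ≤ α + Φ.walkMean k)
    (hbranch : ∀ k l, 1 ≤ k → 1 ≤ l → k + l ≤ Fintype.card V →
      Φ.branch k l ≤ β + Φ.branchMean k l) {r : V}
    (hfinite : hybridExpect (LoopGraph.complete V) 1 r walkSteps ≠ ∞) :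
    ENNReal.ofReal (Φ.walk 1) ≤
      ∑' t, pmfExpect (hybridLaw (LoopGraph.complete V) 1 r t) (phaseCost α β) := by
  obtain ⟨C, hC, hΦ⟩ := Φ.exists_value_le_mul_phaseCost
  rw [hybridExpect_walkSteps] at hfinite
  rw [← pmfExpect_hybridInit_value Φ r]
  refine pmfExpect_le_tsum_markovLaw (fun t s hs => ?_) hC
    (fun t s hs => hΦ s (support_hybridLaw_subset r t hs)) hfinite
  have hs : s.IsLegal 1 := support_hybridLaw_subset r t hs
  rcases s with x | ⟨T, y⟩ | T
  · obtain ⟨hpos, hlt⟩ := card_toFinset_mem_Ico_of_sigmaIn_one_eq_top hs.1 hs.2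
    rw [pmfExpect_hybridStep_aldousBroder_value Φ hs, phaseCost, ← ENNReal.ofReal_coe_nnreal]
    exact (ENNReal.ofReal_le_ofReal (hwalk _ hpos hlt)).trans ENNReal.ofReal_add_le
  · rw [pmfExpect_hybridStep_wilson_value Φ hs, phaseCost, ← ENNReal.ofReal_coe_nnreal]
    exact (ENNReal.ofReal_le_ofReal (hbranch _ _ hs.one_le_card_verts
      hs.one_le_length_loopErasure hs.card_verts_add_length_le)).trans ENNReal.ofReal_add_le
  · exact zero_le

end SizePotential

/-! ### The expected number of steps of Wilson's phase -/

section WilsonPotential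

variable {n k : ℕ}

/-- The expected number of steps that Wilson's algorithm still takes on the complete graph with
self-loops on `n` vertices, when the tree has `k` vertices and the loop-erased path of the current
walk has `l`. -/
def wilsonRemaining (n k l : ℕ) : ℝ :=
  n - k + n / k - ∑ j ∈ Finset.range l, (k : ℝ) / (k + j)

lemma wilsonRemaining_succ (n k l : ℕ) :
    wilsonRemaining n k (l + 1) = wilsonRemaining n k l - k / (k + l) := by
  rw [wilsonRemaining, wilsonRemaining, Finset.sum_range_succ]
  ring

lemma wilsonRemaining_one (hk : 1 ≤ k) : wilsonRemaining n k 1 = (n - k) * (1 + 1 / k) := by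
  have hk : (k : ℝ) ≠ 0 := by positivity
  simp only [wilsonRemaining, Finset.sum_range_one, Nat.cast_zero, add_zero]
  field_simp
  ring

lemma wilsonRemaining_nonneg {l : ℕ} (hkl : k + l ≤ n) : 0 ≤ wilsonRemaining n k l := by
  have hsum : ∑ j ∈ Finset.range l, (k : ℝ) / (k + j) ≤ ∑ j ∈ Finset.range l, 1 :=
    Finset.sum_le_sum fun j _ => div_le_one_of_le₀ (by simp) (by positivity)
  rw [Finset.sum_const, Finset.card_range, nsmul_one] at hsum
  have hkl : (k : ℝ) + l ≤ n := by exact_mod_cast hkl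
  have hdiv : 0 ≤ (n : ℝ) / k := by positivity
  rw [wilsonRemaining]
  linarith

lemma wilsonRemaining_recurrence (hk : 1 ≤ k) (l : ℕ) :
    k * wilsonRemaining n (k + l) 1 + ∑ j ∈ Finset.range l, wilsonRemaining n k (j + 1) +
      (n - (k + l)) * wilsonRemaining n k (l + 1) = n * (wilsonRemaining n k l - 1) := by
  have hk₀ : (0 : ℝ) < k := by positivity
  induction l with
  | zero =>
    have hfirst : wilsonRemaining n k 1 = wilsonRemaining n k 0 - 1 := by
      simp [wilsonRemaining_succ n k 0, hk₀.ne']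
    simp only [add_zero, Finset.range_zero, Finset.sum_empty, Nat.cast_zero, zero_add, hfirst]
    ring
  | succ l ih =>
    have hincrement : k * (wilsonRemaining n (k + l + 1) 1 - wilsonRemaining n (k + l) 1) =
        (n - (k + l + 1)) * (k / (k + l + 1)) - n * (k / (k + l)) := by
      rw [wilsonRemaining_one (by omega), wilsonRemaining_one (by omega)]
      push_cast
      field_simp
      ring
    rw [Finset.sum_range_succ]
    have hlast := wilsonRemaining_succ n k (l + 1)
    have hprev := wilsonRemaining_succ n k l
    push_cast at hlast hprev ⊢
    rw [← add_assoc k l 1, hlast]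
    linear_combination ih + hincrement - n * hprev

/-- The expected number of steps of Wilson's phase that are still to come. -/
def wilsonPotential (hn : 2 ≤ n) : SizePotential n where
  walk k := n - max (k : ℝ) 2
  branch k l := wilsonRemaining n k l
  walk_nonneg k hk := sub_nonneg.2 (max_le (by exact_mod_cast hk) (by exact_mod_cast hn))
  branch_nonneg k l _ hkl := wilsonRemaining_nonneg hkl
  walk_self := sub_eq_zero.2 (max_eq_left (by exact_mod_cast hn)).symm
  branch_self := by rw [wilsonRemaining_one (by omega), sub_self, zero_mul]

lemma wilsonPotential_walk_one (hn : 2 ≤ n) : (wilsonPotential hn).walk 1 = n - 2 := by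
  simp [wilsonPotential]

lemma wilsonPotential_branchMean (hn : 2 ≤ n) (hk : 1 ≤ k) (l : ℕ) :
    1 + (wilsonPotential hn).branchMean k l = (wilsonPotential hn).branch k l := by
  have hn₀ : (n : ℝ) ≠ 0 := by positivity
  simp only [SizePotential.branchMean, wilsonPotential]
  rw [wilsonRemaining_recurrence hk, inv_mul_cancel_left₀ hn₀]
  ring

lemma wilsonPotential_walkMean (hn : 2 ≤ n) (hk : 1 ≤ k) :
    (wilsonPotential hn).walkMean k = (wilsonPotential hn).walk k := by
  have hn₀ : (n : ℝ) ≠ 0 := by positivity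
  simp only [SizePotential.walkMean, wilsonPotential]
  rcases hk.eq_or_lt with rfl | hk
  · norm_num
    field_simp
    ring
  · have hk₂ : (2 : ℝ) ≤ k := by exact_mod_cast hk
    rw [if_neg (by omega), wilsonRemaining_one (by omega), max_eq_left hk₂,
      max_eq_left (by push_cast; linarith)]
    push_cast
    field_simp
    ring

end WilsonPotential

/-! ### The expected length of the first Aldous-Broder branch -/

section AldousBroderPotential

variable {n k : ℕ}

/-- Up to the factor `c`, the order of the expected time that the Aldous-Broder walk still takes to
finish its first branch: with `k` visited vertices each step ends the branch with probability
`k / n`, so that about `min √n (n / k)` steps remain. -/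
def aldousBroderPotential (n : ℕ) (c : ℝ≥0) : SizePotential n where
  walk k := if k < n then c * (n / (k + √n)) else 0
  branch _ _ := 0
  walk_nonneg _ _ := by positivity
  branch_nonneg _ _ _ _ := le_rfl
  walk_self := if_neg (lt_irrefl n)
  branch_self := rfl

lemma aldousBroderPotential_branchMean (c : ℝ≥0) (k l : ℕ) :
    (aldousBroderPotential n c).branchMean k l = (aldousBroderPotential n c).branch k l := by
  simp [SizePotential.branchMean, aldousBroderPotential]

lemma aldousBroderPotential_walk_of_lt (c : ℝ≥0) (hkn : k < n) :
    (aldousBroderPotential n c).walk k = c * (n / (k + √n)) :=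
  if_pos hkn

lemma aldousBroderPotential_walk_le_mul_div (c : ℝ≥0) (n k : ℕ) :
    (aldousBroderPotential n c).walk k ≤ c * (n / (k + √n)) := by
  simp only [aldousBroderPotential]
  split_ifs
  · exact le_rfl
  · positivity

lemma mul_div_add_sqrt_sub (hn : 0 < n) (k : ℕ) :
    n * (n / (k + √n)) - (n - k) * (n / (k + 1 + √n)) =
      n * (n + k * (k + √n)) / ((k + √n) * (k + 1 + √n)) := by
  have hs : 0 < √(n : ℝ) := Real.sqrt_pos.2 (by exact_mod_cast hn)
  have hks : (k : ℝ) + √n ≠ 0 := (add_pos_of_nonneg_of_pos k.cast_nonneg hs).ne'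
  have hks' : (k : ℝ) + 1 + √n ≠ 0 := (add_pos_of_nonneg_of_pos (by positivity) hs).ne'
  field_simp [hks, hks']
  ring

lemma mul_div_add_sqrt_sub_le (hn : 0 < n) (k : ℕ) :
    n * (n / (k + √n)) - (n - k) * (n / (k + 1 + √n)) ≤ n := by
  have hsq : √(n : ℝ) ^ 2 = n := Real.sq_sqrt n.cast_nonneg
  have hs : 0 < √(n : ℝ) := Real.sqrt_pos.2 (by exact_mod_cast hn)
  rw [mul_div_add_sqrt_sub hn, div_le_iff₀ (by positivity)]
  gcongr
  have hk : (0 : ℝ) ≤ k := k.cast_nonneg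
  nlinarith [mul_nonneg hk hs.le]

lemma le_two_mul_mul_div_add_sqrt_sub (hn : 0 < n) (hk : 1 ≤ k) :
    n ≤ 2 * (n * (n / (k + √n)) - (n - k) * (n / (k + 1 + √n))) := by
  have hsq : √(n : ℝ) ^ 2 = n := Real.sq_sqrt n.cast_nonneg
  have hs : 1 ≤ √(n : ℝ) := Real.one_le_sqrt.2 (by exact_mod_cast hn)
  have hk : (1 : ℝ) ≤ k := by exact_mod_cast hk
  have hks : (k + √n) * (k + 1 + √n) ≤ 2 * (n + k * (k + √n)) := by
    nlinarith [mul_nonneg (sub_nonneg.2 hs) (Real.sqrt_nonneg n),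
      mul_nonneg (sub_nonneg.2 hk) k.cast_nonneg]
  rw [mul_div_add_sqrt_sub hn, ← mul_div_assoc, le_div_iff₀ (by positivity)]
  linarith [mul_le_mul_of_nonneg_left hks n.cast_nonneg]

lemma aldousBroderPotential_walk_le (hk : 1 ≤ k) (hkn : k < n) :
    (aldousBroderPotential n 1).walk k ≤ 1 + (aldousBroderPotential n 1).walkMean k := by
  have hn : (0 : ℝ) < n := by exact_mod_cast hk.trans hkn.le
  have hnew : n * (aldousBroderPotential n 1).walk k ≤
      n + (n - k) * (aldousBroderPotential n 1).walk (k + 1) := by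
    rw [aldousBroderPotential_walk_of_lt 1 hkn]
    rcases (Nat.succ_le_of_lt hkn).eq_or_lt with rfl | hkn
    · rw [(aldousBroderPotential (k + 1) 1).walk_self, NNReal.coe_one, one_mul, mul_zero, add_zero]
      refine mul_le_of_le_one_right hn.le (div_le_one_of_le₀ ?_ (by positivity))
      push_cast
      gcongr
      exact Real.one_le_sqrt.2 (by linarith [k.cast_nonneg (α := ℝ)])
    · have hstep := mul_div_add_sqrt_sub_le (n := n) (by omega) k
      rw [aldousBroderPotential_walk_of_lt 1 hkn]
      push_cast
      linarith
  have hrevisit : 0 ≤ k * (if k = 1 then (aldousBroderPotential n 1).walk 1 else 0) :=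
    mul_nonneg k.cast_nonneg
      (ite_nonneg ((aldousBroderPotential n 1).walk_nonneg 1 (hk.trans hkn.le)) le_rfl)
  rw [SizePotential.walkMean, ← sub_le_iff_le_add', le_inv_mul_iff₀ hn]
  simp only [aldousBroderPotential] at hnew hrevisit ⊢
  linarith

/-- The case of a single visited vertex, where a revisit does not end the branch. At `n = 2` it
needs a factor above `8`, whence the choice of `10`. -/
lemma add_ten_mul_div_one_add_sqrt_le (hn : 1 < n) :
    n + 10 * (n / (1 + √n)) ≤
      10 * (n * (n / (1 + √n)) - (n - 1) * (n / (1 + 1 + √n))) := by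
  have hsq : √(n : ℝ) ^ 2 = n := Real.sq_sqrt n.cast_nonneg
  have hs : 4 / 3 ≤ √(n : ℝ) := Real.le_sqrt_of_sq_le
    (le_trans (by norm_num) (Nat.ofNat_le_cast.2 hn))
  have hrec := mul_div_add_sqrt_sub (n := n) (by omega) 1
  rw [Nat.cast_one] at hrec
  have hgain : n * (n + 1 * (1 + √n)) / ((1 + √n) * (1 + 1 + √n)) =
      n / (1 + √n) + n * (√n - 1) / (2 + √n) := by
    nth_rewrite 2 [← hsq]
    field_simp
    ring
  have hmain : (n : ℝ) ≤ 10 * (n * (√n - 1) / (2 + √n)) := by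
    rw [← mul_div_assoc, le_div_iff₀ (by positivity), mul_left_comm]
    gcongr
    linarith
  rw [hrec, hgain]
  linarith

lemma aldousBroderPotential_le_walk (hk : 1 ≤ k) (hkn : k < n) :
    1 + (aldousBroderPotential n 10).walkMean k ≤ (aldousBroderPotential n 10).walk k := by
  have hn : (0 : ℝ) < n := by exact_mod_cast hk.trans hkn.le
  have hnew := mul_le_mul_of_nonneg_left (aldousBroderPotential_walk_le_mul_div 10 n (k + 1))
    (sub_nonneg.2 (Nat.cast_le (α := ℝ).2 hkn.le))
  rw [← le_sub_iff_add_le', SizePotential.walkMean, inv_mul_le_iff₀ hn,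
    aldousBroderPotential_walk_of_lt 10 hkn]
  simp only [NNReal.coe_ofNat, Nat.cast_add, Nat.cast_one] at hnew ⊢
  split_ifs with h
  · subst h
    rw [aldousBroderPotential_walk_of_lt 10 hkn]
    have hroot := add_ten_mul_div_one_add_sqrt_le hkn
    simp only [NNReal.coe_ofNat, Nat.cast_one, one_mul] at hnew ⊢
    linarith
  · have hstep := le_two_mul_mul_div_add_sqrt_sub (n := n) (by omega) hk
    simp only [aldousBroderPotential] at hnew ⊢
    linarith

end AldousBroderPotential

/-! ### The two phases of `Hybrid(G, 1)` -/

section Phases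

variable {V : Type*} [Fintype V] [DecidableEq V] [Nontrivial V] (r : V)

lemma hybridExpect_aldousBroderSteps_le :
    hybridExpect (LoopGraph.complete V) 1 r aldousBroderSteps ≤
      ENNReal.ofReal (10 * √(Fintype.card V)) := by
  rw [hybridExpect_aldousBroderSteps]
  refine ((aldousBroderPotential _ 10).tsum_phaseCost_le
    (fun k hk hkn => by simpa using aldousBroderPotential_le_walk hk hkn)
    (fun k l _ _ _ => by simp [aldousBroderPotential_branchMean]) r).trans
    (ENNReal.ofReal_le_ofReal ((aldousBroderPotential_walk_le_mul_div _ _ _).trans ?_))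
  rw [NNReal.coe_ofNat, Nat.cast_one]
  gcongr
  rw [div_le_iff₀ (by positivity), mul_one_add, Real.mul_self_sqrt (Nat.cast_nonneg _)]
  exact le_add_of_nonneg_left (Real.sqrt_nonneg _)

lemma hybridExpect_wilsonSteps_le :
    hybridExpect (LoopGraph.complete V) 1 r wilsonSteps ≤
      ENNReal.ofReal (Fintype.card V - 2) := by
  have hn : 2 ≤ Fintype.card V := Fintype.one_lt_card
  rw [hybridExpect_wilsonSteps, ← wilsonPotential_walk_one hn]
  refine (wilsonPotential hn).tsum_phaseCost_le (fun k hk _ => ?_) (fun k l hk _ _ => ?_) r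
  · rw [NNReal.coe_zero, zero_add, wilsonPotential_walkMean hn hk]
  · rw [NNReal.coe_one, wilsonPotential_branchMean hn hk]

lemma hybridExpect_walkSteps_ne_top :
    hybridExpect (LoopGraph.complete V) 1 r walkSteps ≠ ∞ := by
  rw [hybridExpect_walkSteps_eq_add]
  exact ENNReal.add_ne_top.2
    ⟨ne_top_of_le_ne_top ENNReal.ofReal_ne_top (hybridExpect_aldousBroderSteps_le r),
      ne_top_of_le_ne_top ENNReal.ofReal_ne_top (hybridExpect_wilsonSteps_le r)⟩

lemma le_hybridExpect_aldousBroderSteps :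
    ENNReal.ofReal (√(Fintype.card V) / 2) ≤
      hybridExpect (LoopGraph.complete V) 1 r aldousBroderSteps := by
  rw [hybridExpect_aldousBroderSteps]
  refine le_trans (ENNReal.ofReal_le_ofReal ?_) ((aldousBroderPotential _ 1).le_tsum_phaseCost
    (fun k hk hkn => by simpa using aldousBroderPotential_walk_le hk hkn)
    (fun k l _ _ _ => by simp [aldousBroderPotential_branchMean])
    (hybridExpect_walkSteps_ne_top r))
  have hn : 1 < Fintype.card V := Fintype.one_lt_card
  have hs : 1 ≤ √(Fintype.card V : ℝ) := Real.one_le_sqrt.2 (by exact_mod_cast hn.le)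
  rw [aldousBroderPotential_walk_of_lt 1 hn, NNReal.coe_one, one_mul, Nat.cast_one,
    div_le_div_iff₀ two_pos (by positivity), mul_one_add, Real.mul_self_sqrt (Nat.cast_nonneg _)]
  have hsn := mul_le_mul_of_nonneg_left hs (Real.sqrt_nonneg (Fintype.card V))
  rw [mul_one, Real.mul_self_sqrt (Nat.cast_nonneg _)] at hsn
  linarith

theorem hybridExpect_wilsonSteps_complete :
    hybridExpect (LoopGraph.complete V) 1 r wilsonSteps =
      ENNReal.ofReal (Fintype.card V - 2) := by
  refine (hybridExpect_wilsonSteps_le r).antisymm ?_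
  have hn : 2 ≤ Fintype.card V := Fintype.one_lt_card
  rw [hybridExpect_wilsonSteps, ← wilsonPotential_walk_one hn]
  refine (wilsonPotential hn).le_tsum_phaseCost (fun k hk _ => ?_) (fun k l hk _ _ => ?_)
    (hybridExpect_walkSteps_ne_top r)
  · rw [NNReal.coe_zero, zero_add, wilsonPotential_walkMean hn hk]
  · rw [NNReal.coe_one, wilsonPotential_branchMean hn hk]

end Phases

end

theorem mainTheorem5 :
    (∃ c C : ℝ, 0 < c ∧ 0 < C ∧ ∃ N : ℕ,
      ∀ (V : Type*) [Fintype V] [DecidableEq V] (r : V), N ≤ Fintype.card V →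
        (ENNReal.ofReal (Fintype.card V + c * √(Fintype.card V)) ≤
            hybridExpect (LoopGraph.complete V) 1 r walkSteps ∧
          hybridExpect (LoopGraph.complete V) 1 r walkSteps ≤
            ENNReal.ofReal (Fintype.card V + C * √(Fintype.card V))) ∧
        (ENNReal.ofReal (c * √(Fintype.card V)) ≤
            hybridExpect (LoopGraph.complete V) 1 r aldousBroderSteps ∧
          hybridExpect (LoopGraph.complete V) 1 r aldousBroderSteps ≤
            ENNReal.ofReal (C * √(Fintype.card V)))) ∧
    (∀ (V : Type*) [Fintype V] [DecidableEq V] (r : V), 2 ≤ Fintype.card V →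
      hybridExpect (LoopGraph.complete V) 1 r wilsonSteps =
        ENNReal.ofReal (Fintype.card V - 2)) := by
  refine ⟨⟨1 / 4, 10, by norm_num, by norm_num, 64, fun V _ _ r hV => ?_⟩, fun V _ _ r hV => ?_⟩
  · have : Nontrivial V := Fintype.one_lt_card_iff_nontrivial.1 (by omega)
    have hV : (64 : ℝ) ≤ Fintype.card V := by exact_mod_cast hV
    have hs : 8 ≤ √(Fintype.card V : ℝ) := Real.le_sqrt_of_sq_le (by linarith)
    have hlower := le_hybridExpect_aldousBroderSteps r
    have hupper := hybridExpect_aldousBroderSteps_le r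
    rw [hybridExpect_walkSteps_eq_add, hybridExpect_wilsonSteps_complete]
    refine ⟨⟨?_, ?_⟩, (ENNReal.ofReal_le_ofReal (by linarith)).trans hlower, hupper⟩
    · refine le_trans ?_ (add_le_add_left hlower _)
      rw [← ENNReal.ofReal_add (by positivity) (by linarith)]
      exact ENNReal.ofReal_le_ofReal (by linarith)
    · refine (add_le_add_left hupper _).trans ?_
      rw [← ENNReal.ofReal_add (by positivity) (by linarith)]
      exact ENNReal.ofReal_le_ofReal (by linarith)
  · have : Nontrivial V := Fintype.one_lt_card_iff_nontrivial.1 hV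
    exact hybridExpect_wilsonSteps_complete r
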